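/- Let $\lambda:\mathbb{Z}\to\mathbb{R}$ and $w:\mathbb{Z}\to\mathbb{R}\setminus\{0\}$, and let $\mathcal{J}$ be the doubly infinite Jacobi matrix with diagonal $\lambda$ and off-diagonal $w$, that is, $\mathcal{J}_{n,n}=\lambda_n$, $\mathcal{J}_{n,n+1}=\mathcal{J}_{n+1,n}=w_n$ for $n\in\mathbb{Z}$, all other entries being zero. Put $\mathbb{C}_0^\lambda:=\mathbb{C}\setminus\overline{\{\lambda_n\mid n\in\mathbb{Z}\}}$, and let $\operatorname{der}(\lambda)$ be the set of all (finite) limit points of convergent subsequences of $\lambda$. Assume that $$\sum_{n=-\infty}^{\infty}\left|\frac{w_n^2}{(\lambda_n-z_0)(\lambda_{n+1}-z_0)}\right|<\infty$$ for at least one $z_0\in\mathbb{C}_0^\lambda$, and that $\operatorname{der}(\lambda)\neq\mathbb{R}$. For a complex sequence $x=\{x_k\}_{k\in\mathbb{Z}}$ with $\sum_{k\in\mathbb{Z}}|x_kx_{k+1}|<\infty$ let $$\mathfrak{F}(x):=1+\sum_{m=1}^{\infty}(-1)^m\sum_{k_1=-\infty}^{\infty}\ \sum_{k_2=k_1+2}^{\infty}\cdots\sum_{k_m=k_{m-1}+2}^{\infty}\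 \prod_{j=1}^m x_{k_j}x_{k_j+1},$$ and define the characteristic function of $\mathcal{J}$ by $$F_{\mathcal{J}}(z):=\mathfrak{F}\left(\left\{\frac{\gamma_n^2}{z-\lambda_n}\right\}_{n=-\infty}^{\infty}\right),\qquad z\in\mathbb{C}_0^\lambda,$$ where $\gamma:\mathbb{Z}\to\mathbb{C}$ is any sequence with $\gamma_n\gamma_{n+1}=w_n$ for all $n\in\mathbb{Z}$. Then every zero $z\in\mathbb{C}_0^\lambda$ of $F_{\mathcal{J}}$ is real and simple (that is, $F_{\mathcal{J}}$ is analytic at $z$ and vanishes there to order exactly $1$). -/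

import Mathlib

open Filter Topology

noncomputable section

namespace DoublyInfiniteJacobi

/-- The nested sum `∑_{k₁ ≥ a} ∑_{k₂ ≥ k₁ + 2} ⋯ ∑_{k_m ≥ k_{m-1} + 2} ∏_j x_{k_j} x_{k_j + 1}`,
equal to `1` for `m = 0`. -/
def nestedSum (x : ℤ → ℂ) : ℕ → ℤ → ℂ
  | 0, _ => 1
  | m + 1, a => ∑' k : {k : ℤ // a ≤ k}, x k * x (k + 1) * nestedSum x m (k + 2)

/-- The function `𝔉` of a doubly infinite sequence:
`1 + ∑_{m ≥ 1} (-1)^m ∑_{k₁ ∈ ℤ} ∑_{k₂ ≥ k₁ + 2} ⋯ ∑_{k_m ≥ k_{m-1} + 2} ∏_j x_{k_j} x_{k_j + 1}`.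
It is meaningful when `∑ |x_k x_{k+1}| < ∞`; all the sums then converge absolutely.
The index `m` below is the `m` of the formula lowered by one. -/
def frakF (x : ℤ → ℂ) : ℂ :=
  1 + ∑' m : ℕ, (-1) ^ (m + 1) * ∑' k : ℤ, x k * x (k + 1) * nestedSum x m (k + 2)

/-- `ℂ₀^λ`: the complement of the closure of the range of `λ`. -/
def domC0 (lam : ℤ → ℂ) : Set ℂ := (closure (Set.range lam))ᶜ

/-- `der(λ)`: the limit points of convergent subsequences of `λ`, that is, the points each of whose
neighbourhoods contains `λ n` for infinitely many indices `n`. -/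
def der (lam : ℤ → ℂ) : Set ℂ := {z | MapClusterPt z cofinite lam}

/-- `∑_{n ∈ ℤ} |w_n² / ((λ_n - z₀) (λ_{n+1} - z₀))| < ∞`. -/
def ConvergenceCondition (lam w : ℤ → ℂ) (z₀ : ℂ) : Prop :=
  Summable fun n : ℤ => ‖w n ^ 2 / ((lam n - z₀) * (lam (n + 1) - z₀))‖

/-- `γ` satisfies the difference equation `γ_n γ_{n+1} = w_n`. -/
def IsFactorSeq (w γ : ℤ → ℂ) : Prop := ∀ n : ℤ, γ n * γ (n + 1) = w n

/-- The characteristic function `F_𝒥(z) = 𝔉({γ_n² / (z - λ_n)})` of the doubly infinite Jacobi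
matrix with diagonal `λ` and off-diagonal `w`, where `γ` is any sequence with
`γ_n γ_{n+1} = w_n`. -/
def charFun (lam γ : ℤ → ℂ) (z : ℂ) : ℂ := frakF fun n => γ n ^ 2 / (z - lam n)

/-- The values of a factor sequence at `0, 1, 2, …`, starting from `1`. -/
def factorAux (v : ℕ → ℂ) : ℕ → ℂ
  | 0 => 1
  | n + 1 => v n / factorAux v n

theorem factorAux_ne_zero {v : ℕ → ℂ} (hv : ∀ n, v n ≠ 0) (n : ℕ) : factorAux v n ≠ 0 := by
  induction n with
  | zero => simp [factorAux]
  | succ n ih => exact div_ne_zero (hv n) ih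

/-- A factor sequence exists for every nowhere vanishing `w`. -/
theorem exists_isFactorSeq (w : ℤ → ℂ) (hw : ∀ n, w n ≠ 0) : ∃ γ : ℤ → ℂ, IsFactorSeq w γ := by
  have hp := factorAux_ne_zero (v := fun n : ℕ => w n) fun n => hw n
  have hm := factorAux_ne_zero (v := fun n : ℕ => w (-(n : ℤ) - 1)) fun n => hw _
  refine ⟨fun n => if 0 ≤ n then factorAux (fun n : ℕ => w n) n.toNat
    else factorAux (fun n : ℕ => w (-(n : ℤ) - 1)) (-n).toNat, fun n => ?_⟩
  rcases le_or_gt 0 n with h | h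
  · obtain ⟨m, rfl⟩ := Int.eq_ofNat_of_zero_le h
    have h1 : (0 : ℤ) ≤ (m : ℤ) + 1 := by omega
    have h2 : ((m : ℤ) + 1).toNat = m + 1 := by omega
    simp only [h, h1, if_true, h2, Int.toNat_natCast, factorAux]
    field_simp [hp m]
  · obtain ⟨m, rfl⟩ : ∃ m : ℕ, n = -(m : ℤ) - 1 := ⟨(-n - 1).toNat, by omega⟩
    have h2 : (-(-(m : ℤ) - 1)).toNat = m + 1 := by omega
    have h3 : ¬ (0 : ℤ) ≤ -(m : ℤ) - 1 := by omega
    rcases Nat.eq_zero_or_pos m with rfl | hm0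
    · simp [factorAux]
    · have h4 : ¬ (0 : ℤ) ≤ -(m : ℤ) - 1 + 1 := by omega
      have h5 : (-(-(m : ℤ) - 1 + 1)).toNat = m := by omega
      simp only [h3, h4, if_false, h2, h5, factorAux]
      field_simp [hm m]

end DoublyInfiniteJacobi

end

noncomputable section

namespace JacobiZeros

open DoublyInfiniteJacobi

/-! The characteristic function is a signed sum over finite index sets with gaps at least 2, with
weights p_k = w_k² / ((z - λ_k)(z - λ_{k+1})). Restricting the indices to a right or left half-line
gives three-term recursions; after rescaling by `weight` these become solutions ψ, φ of the Jacobi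
equation attached to +∞ and -∞, with Wronskian -F(z) (`sol_wronskian`).

The kernel u_k = φ_{min(k,n)} ψ_{max(k,n)} then solves (𝒥 - z)u = -F(z) δ_n. As 𝒥 is real symmetric,
Green's identity yields |Im z| |φ_m ψ_n|² ≤ |φ_n ψ_n| |F(z)| for m ≤ n
(`abs_im_mul_sq_norm_sol_le`). Nothing is divided by F, so this also holds at zeros.

Choose m, n with φ_m ψ_n ≠ 0 at a zero x. The bound at x forces Im x = 0. Near x it makes |F| at
least a multiple of |Im z|, which excludes order 2 or more (`analyticOrderAt_eq_one_of_im_bound`).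
-/

/-- The nested sum over `a ≤ k₁`, `k₁ + 2 ≤ k₂`, …, of `∏ p_{k_j}`. -/
def gapSum (p : ℤ → ℂ) : ℕ → ℤ → ℂ
  | 0, _ => 1
  | m + 1, a => ∑' j : ℕ, p (a + j) * gapSum p m (a + j + 2)

/-- The alternating sum of the nested sums starting at `a`. -/
def rightSum (p : ℤ → ℂ) (a : ℤ) : ℂ := ∑' m : ℕ, (-1) ^ m * gapSum p m a

/-- The same sum over indices below `n`, obtained by reflection. -/
def leftSum (p : ℤ → ℂ) (n : ℤ) : ℂ := rightSum (fun k => p (-k - 1)) (-n)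

/-- The alternating sum of the nested sums over all of `ℤ`. -/
def fullSum (p : ℤ → ℂ) : ℂ := 1 - ∑' k : ℤ, p k * rightSum p (k + 2)

/-- The natural numbers enumerate the integers from `a` on. -/
def natEquivGe (a : ℤ) : ℕ ≃ {k : ℤ // a ≤ k} where
  toFun j := ⟨a + j, by omega⟩
  invFun k := (k.1 - a).toNat
  left_inv j := by simp
  right_inv k := by
    have := k.2
    ext
    simp only [Int.toNat_sub_of_le this]
    omega

theorem nestedSum_eq_gapSum (x : ℤ → ℂ) (m : ℕ) (a : ℤ) :
    nestedSum x m a = gapSum (fun k => x k * x (k + 1)) m a := by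
  induction m generalizing a with
  | zero => rfl
  | succ m ih =>
    simp only [nestedSum, gapSum]
    rw [← (natEquivGe a).tsum_eq]
    simp [natEquivGe, ih]

theorem injective_intShift (a : ℤ) : Function.Injective fun j : ℕ => a + (j : ℤ) := by
  intro i j h
  simpa using h

/-- The tail sum of `q` from `a` on. -/
def tailSum (q : ℤ → ℝ) (a : ℤ) : ℝ := ∑' j : ℕ, q (a + j)

/-! ### Geometric bounds and recursion for the gap sums. -/

section Bounds

variable {q : ℤ → ℝ}

theorem summable_shift (hq : Summable q) (a : ℤ) : Summable fun j : ℕ => q (a + j) :=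
  hq.comp_injective (injective_intShift a)

theorem tailSum_eq (hq : Summable q) (a : ℤ) : tailSum q a = q a + tailSum q (a + 1) := by
  unfold tailSum
  rw [(summable_shift hq a).tsum_eq_zero_add]
  simp only [Nat.cast_zero, add_zero, Nat.cast_add, Nat.cast_one]
  congr 2
  ext j
  congr 1
  ring

theorem tailSum_le (hq : Summable q) (hq0 : ∀ k, 0 ≤ q k) (a : ℤ) : tailSum q a ≤ ∑' k, q k :=
  tsum_comp_le_tsum_of_inj hq hq0 (injective_intShift a)

theorem tailSum_nonneg (hq0 : ∀ k, 0 ≤ q k) (a : ℤ) : 0 ≤ tailSum q a :=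
  tsum_nonneg fun _ => hq0 _

/-- With Q the tail sum, e^{2Q_a} - e^{2Q_{a+1}} = (e^{2q_a} - 1) e^{2Q_{a+1}} ≥ 2 q_a e^{2Q_{a+2}}.
The right side of the statement telescopes when summed over `a`. -/
theorem mul_exp_tailSum_le (hq : Summable q) (hq0 : ∀ k, 0 ≤ q k) (a : ℤ) :
    q a * Real.exp (2 * tailSum q (a + 2)) ≤
      (Real.exp (2 * tailSum q a) - Real.exp (2 * tailSum q (a + 1))) / 2 := by
  have h1 := tailSum_eq hq a
  have h2 := tailSum_eq hq (a + 1)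
  rw [show a + 1 + 1 = a + 2 by ring] at h2
  have h3 : Real.exp (2 * tailSum q (a + 2)) ≤ Real.exp (2 * tailSum q (a + 1)) := by
    gcongr
    linarith [hq0 (a + 1)]
  have h4 : Real.exp (2 * tailSum q a) = Real.exp (2 * q a) * Real.exp (2 * tailSum q (a + 1)) := by
    rw [← Real.exp_add, h1]
    ring_nf
  have h5 := Real.add_one_le_exp (2 * q a)
  have h6 := Real.exp_pos (2 * tailSum q (a + 1))
  have h7 := mul_le_mul_of_nonneg_left h3 (hq0 a)
  rw [h4]
  nlinarith

theorem tsum_mul_exp_tailSum_le (hq : Summable q) (hq0 : ∀ k, 0 ≤ q k) (a : ℤ) :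
    ∑' j : ℕ, q (a + j) * Real.exp (2 * tailSum q (a + j + 2)) ≤
      Real.exp (2 * tailSum q a) / 2 := by
  refine Real.tsum_le_of_sum_range_le (fun j => by have := hq0 (a + j); positivity) fun n => ?_
  have key : ∑ j ∈ Finset.range n, q (a + j) * Real.exp (2 * tailSum q (a + j + 2)) ≤
      (Real.exp (2 * tailSum q a) - Real.exp (2 * tailSum q (a + n))) / 2 := by
    induction n with
    | zero => simp
    | succ n ih =>
      rw [Finset.sum_range_succ]
      have := mul_exp_tailSum_le hq hq0 (a + n)
      rw [show a + ((n + 1 : ℕ) : ℤ) = a + n + 1 by push_cast; ring]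
      linarith
  linarith [Real.exp_pos (2 * tailSum q (a + n))]

variable {p : ℤ → ℂ}

theorem summable_mul_exp_tailSum (hq : Summable q) (hq0 : ∀ k, 0 ≤ q k) (a : ℤ) :
    Summable fun j : ℕ => q (a + j) * Real.exp (2 * tailSum q (a + j + 2)) := by
  refine Summable.of_nonneg_of_le (fun j => by have := hq0 (a + j); positivity) (fun j => ?_)
    ((summable_shift hq a).mul_right (Real.exp (2 * ∑' k, q k)))
  have := hq0 (a + j)
  have := tailSum_le hq hq0 (a + j + 2)
  gcongr

/-- The weight e^{2Q} is chosen so that each summation gains a factor 1/2. This gives geometric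
decay in `m` without any smallness of `q`. -/
theorem norm_gapSum_le_exp (hq : Summable q) (hp : ∀ k, ‖p k‖ ≤ q k) (m : ℕ) (a : ℤ) :
    ‖gapSum p m a‖ ≤ (1 / 2) ^ m * Real.exp (2 * tailSum q a) := by
  have hq0 : ∀ k, 0 ≤ q k := fun k => (norm_nonneg _).trans (hp k)
  induction m generalizing a with
  | zero =>
    have := tailSum_nonneg hq0 a
    simpa [gapSum] using this
  | succ m ih =>
    have hs := (summable_mul_exp_tailSum hq hq0 a).mul_left ((1 / 2) ^ m)
    have hle : ∀ j : ℕ, ‖p (a + j) * gapSum p m (a + j + 2)‖ ≤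
        (1 / 2) ^ m * (q (a + j) * Real.exp (2 * tailSum q (a + j + 2))) := fun j => by
      rw [norm_mul, mul_left_comm]
      exact mul_le_mul (hp _) (ih _) (norm_nonneg _) (hq0 _)
    refine (tsum_of_norm_bounded hs.hasSum hle).trans ?_
    rw [tsum_mul_left, pow_succ, mul_assoc]
    have := tsum_mul_exp_tailSum_le hq hq0 a
    gcongr
    linarith

theorem norm_gapSum_le (hq : Summable q) (hp : ∀ k, ‖p k‖ ≤ q k) (m : ℕ) (a : ℤ) :
    ‖gapSum p m a‖ ≤ (1 / 2) ^ m * Real.exp (2 * ∑' k, q k) := by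
  have := tailSum_le hq (fun k => (norm_nonneg _).trans (hp k)) a
  refine (norm_gapSum_le_exp hq hp m a).trans ?_
  gcongr

theorem summable_geometric_mul (C : ℝ) : Summable fun m : ℕ => (1 / 2 : ℝ) ^ m * C :=
  (summable_geometric_of_lt_one (by norm_num) (by norm_num)).mul_right C

theorem norm_alternating (m : ℕ) (c : ℂ) : ‖(-1) ^ m * c‖ = ‖c‖ := by simp

theorem summable_rightSum (hq : Summable q) (hp : ∀ k, ‖p k‖ ≤ q k) (a : ℤ) :
    Summable fun m : ℕ => (-1) ^ m * gapSum p m a :=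
  Summable.of_norm_bounded (summable_geometric_mul _) fun m => by
    rw [norm_alternating]
    exact norm_gapSum_le hq hp m a

theorem norm_rightSum_le (hq : Summable q) (hp : ∀ k, ‖p k‖ ≤ q k) (a : ℤ) :
    ‖rightSum p a‖ ≤ 2 * Real.exp (2 * ∑' k, q k) := by
  refine (tsum_of_norm_bounded (summable_geometric_mul (Real.exp (2 * ∑' k, q k))).hasSum
    fun m => ?_).trans ?_
  · rw [norm_alternating]
    exact norm_gapSum_le hq hp m a
  · rw [tsum_mul_right, tsum_geometric_of_lt_one (by norm_num) (by norm_num)]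
    norm_num

/-- Interchange of the sum over the order `m` with the sum over the first index. -/
theorem tsum_alternating_eq {ι : Type*} (hq : Summable q) (hp : ∀ k, ‖p k‖ ≤ q k) {e : ι → ℤ}
    (he : Function.Injective e) :
    ∑' m : ℕ, (-1) ^ (m + 1) * ∑' i, p (e i) * gapSum p m (e i + 2) =
      -∑' i, p (e i) * rightSum p (e i + 2) := by
  have hs : Summable (Function.uncurry fun (m : ℕ) (i : ι) =>
      (-1) ^ (m + 1) * (p (e i) * gapSum p m (e i + 2))) := by
    refine Summable.of_norm_bounded ((summable_geometric_mul
      (Real.exp (2 * ∑' k, q k))).mul_of_nonneg (hq.comp_injective he)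
      (fun m => by positivity) (fun i => (norm_nonneg _).trans (hp _))) ?_
    rintro ⟨m, i⟩
    simp only [Function.uncurry, Function.comp]
    rw [norm_alternating, norm_mul, mul_comm]
    exact mul_le_mul (norm_gapSum_le hq hp m _) (hp _) (norm_nonneg _) (by positivity)
  simp_rw [← tsum_mul_left]
  rw [← hs.tsum_comm, ← tsum_neg]
  congr 1
  ext i
  rw [rightSum, ← tsum_mul_left, ← tsum_neg]
  congr 1
  ext m
  ring

theorem rightSum_eq (hq : Summable q) (hp : ∀ k, ‖p k‖ ≤ q k) (a : ℤ) :
    rightSum p a = 1 - ∑' j : ℕ, p (a + j) * rightSum p (a + j + 2) := by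
  rw [rightSum, (summable_rightSum hq hp a).tsum_eq_zero_add]
  simp only [gapSum, pow_zero, mul_one]
  rw [tsum_alternating_eq hq hp (injective_intShift a), sub_eq_add_neg]

theorem frakF_eq_fullSum (hq : Summable q) (x : ℤ → ℂ) (hp : ∀ k, ‖x k * x (k + 1)‖ ≤ q k) :
    frakF x = fullSum fun k => x k * x (k + 1) := by
  simp only [frakF, nestedSum_eq_gapSum]
  rw [fullSum, sub_eq_add_neg]
  exact congrArg (1 + ·)
    (tsum_alternating_eq (p := fun k => x k * x (k + 1)) (e := id) hq hp Function.injective_id)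

theorem summable_mul_rightSum (hq : Summable q) (hp : ∀ k, ‖p k‖ ≤ q k) :
    Summable fun k : ℤ => p k * rightSum p (k + 2) := by
  refine Summable.of_norm_bounded (hq.mul_right (2 * Real.exp (2 * ∑' k, q k))) fun k => ?_
  rw [norm_mul]
  exact mul_le_mul (hp _) (norm_rightSum_le hq hp _) (norm_nonneg _)
    ((norm_nonneg _).trans (hp k))

/-- An index set from `a` on either omits `a`, or contains it and continues from `a + 2` with one
extra sign. -/
theorem rightSum_rec (hq : Summable q) (hp : ∀ k, ‖p k‖ ≤ q k) (a : ℤ) :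
    rightSum p a = rightSum p (a + 1) - p a * rightSum p (a + 2) := by
  have hs : Summable fun j : ℕ => p (a + j) * rightSum p (a + j + 2) :=
    (summable_mul_rightSum hq hp).comp_injective (injective_intShift a)
  rw [rightSum_eq hq hp a, rightSum_eq hq hp (a + 1), hs.tsum_eq_zero_add]
  simp only [Nat.cast_zero, add_zero, Nat.cast_add, Nat.cast_one]
  simp only [add_assoc, add_comm (1 : ℤ)]
  ring

end Bounds

/-! ### Limits at ±∞ and the discrete Wronskian. -/

/-- Writing all tails over the same index set ℤ lets dominated convergence handle both limits in
`a`. -/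
theorem tsum_shift_eq_indicator (h : ℤ → ℂ) (a : ℤ) :
    ∑' j : ℕ, h (a + j) = ∑' k : ℤ, (Set.Ici a).indicator h k := by
  rw [← tsum_subtype]
  exact (natEquivGe a).tsum_eq fun k : Set.Ici a => h k

theorem tendsto_tsum_shift_atTop {h : ℤ → ℂ} (hh : Summable fun k => ‖h k‖) :
    Tendsto (fun a : ℤ => ∑' j : ℕ, h (a + j)) atTop (𝓝 0) := by
  simp_rw [tsum_shift_eq_indicator]
  have := tendsto_tsum_of_dominated_convergence (𝓕 := atTop) (g := fun _ => (0 : ℂ))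
    (f := fun (a k : ℤ) => (Set.Ici a).indicator h k) hh (fun k => ?_)
    (Eventually.of_forall fun a k => norm_indicator_le_norm_self h k)
  · simpa using this
  · refine tendsto_const_nhds.congr' ?_
    filter_upwards [eventually_gt_atTop k] with a ha
    simp [ha]

theorem tendsto_tsum_shift_atBot {h : ℤ → ℂ} (hh : Summable fun k => ‖h k‖) :
    Tendsto (fun a : ℤ => ∑' j : ℕ, h (a + j)) atBot (𝓝 (∑' k, h k)) := by
  simp_rw [tsum_shift_eq_indicator]
  refine tendsto_tsum_of_dominated_convergence hh (fun k => ?_)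
    (Eventually.of_forall fun a k => norm_indicator_le_norm_self h k)
  refine tendsto_const_nhds.congr' ?_
  filter_upwards [eventually_le_atBot k] with a ha
  simp [ha]

section Limits

variable {p : ℤ → ℂ}

theorem tendsto_rightSum_atTop (hp : Summable fun k => ‖p k‖) :
    Tendsto (rightSum p) atTop (𝓝 1) := by
  have := (tendsto_tsum_shift_atTop (summable_mul_rightSum hp fun k => le_rfl).norm).const_sub 1
  rw [sub_zero] at this
  exact this.congr fun a => (rightSum_eq hp (fun k => le_rfl) a).symm

theorem tendsto_rightSum_atBot (hp : Summable fun k => ‖p k‖) :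
    Tendsto (rightSum p) atBot (𝓝 (fullSum p)) := by
  have := (tendsto_tsum_shift_atBot (summable_mul_rightSum hp fun k => le_rfl).norm).const_sub 1
  exact this.congr fun a => (rightSum_eq hp (fun k => le_rfl) a).symm

theorem summable_reflect {q : ℤ → ℝ} (hq : Summable q) : Summable fun k => q (-k - 1) :=
  hq.comp_injective (i := fun k : ℤ => -k - 1) fun i j h => by simpa using h

theorem leftSum_rec (hp : Summable fun k => ‖p k‖) (n : ℤ) :
    leftSum p n = leftSum p (n - 1) - p (n - 1) * leftSum p (n - 2) := by
  have := rightSum_rec (p := fun k => p (-k - 1)) (summable_reflect hp) (fun k => le_rfl) (-n)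
  simp only [leftSum]
  rw [this]
  ring_nf

theorem tendsto_leftSum_atBot (hp : Summable fun k => ‖p k‖) :
    Tendsto (leftSum p) atBot (𝓝 1) := by
  have hr : Summable fun k : ℤ => ‖p (-k - 1)‖ := summable_reflect (q := fun k => ‖p k‖) hp
  exact (tendsto_rightSum_atTop hr).comp tendsto_neg_atBot_atTop

theorem tendsto_zero_of_summable (hp : Summable fun k => ‖p k‖) :
    Tendsto p cofinite (𝓝 0) :=
  hp.of_norm.tendsto_cofinite_zero

theorem tendsto_atTop_zero (hp : Summable fun k => ‖p k‖) : Tendsto p atTop (𝓝 0) :=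
  (tendsto_zero_of_summable hp).mono_left (by rw [Int.cofinite_eq]; exact le_sup_right)

theorem tendsto_atBot_zero (hp : Summable fun k => ‖p k‖) : Tendsto p atBot (𝓝 0) :=
  (tendsto_zero_of_summable hp).mono_left (by rw [Int.cofinite_eq]; exact le_sup_left)

/-- The two products account for the index sets omitting `n` and those containing it. The proof
shows independence of `n` by the recursions and evaluates at -∞, where `leftSum` tends to 1,
`rightSum` to `fullSum`, and `p` to 0. -/
theorem wronskian_eq_fullSum (hp : Summable fun k => ‖p k‖) (n : ℤ) :
    leftSum p n * rightSum p (n + 1) - p n * leftSum p (n - 1) * rightSum p (n + 2) =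
      fullSum p := by
  set V : ℤ → ℂ := fun n =>
    leftSum p n * rightSum p (n + 1) - p n * leftSum p (n - 1) * rightSum p (n + 2) with hV
  have hstep : ∀ n, V (n + 1) = V n := fun n => by
    simp only [hV]
    have h1 := leftSum_rec hp (n + 1)
    have h2 := rightSum_rec hp (fun k => le_rfl) (n + 1)
    rw [show n + 1 - 1 = n by ring, show n + 1 - 2 = n - 1 by ring] at h1
    rw [show n + 1 + 1 = n + 2 by ring] at *
    rw [show n + 1 - 1 = n by ring, h1, h2]
    ring
  have hconst : ∀ n, V n = V 0 := fun n => by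
    induction n with
    | zero => rfl
    | succ i ih => rw [hstep, ih]
    | pred i ih => rw [← ih, ← hstep (-i - 1), sub_add_cancel]
  have hlim : Tendsto V atBot (𝓝 (fullSum p)) := by
    have hg := tendsto_leftSum_atBot hp
    have hf := tendsto_rightSum_atBot hp
    have sh : ∀ c : ℤ, Tendsto (fun n : ℤ => n + c) atBot atBot := fun c =>
      tendsto_atBot_add_const_right _ c tendsto_id
    have := (hg.mul (hf.comp (sh 1))).sub
      (((tendsto_atBot_zero hp).mul (hg.comp (sh (-1)))).mul (hf.comp (sh 2)))
    simpa [hV, sub_eq_add_neg] using this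
  have hlim2 : Tendsto V atBot (𝓝 (V n)) :=
    tendsto_const_nhds.congr fun k => (hconst n).trans (hconst k).symm
  exact tendsto_nhds_unique hlim2 hlim

end Limits

/-! ### Analyticity in z from locally uniform majorants. -/

section Analytic

variable {U : Set ℂ} {p : ℂ → ℤ → ℂ} {q : ℤ → ℝ}

theorem differentiableOn_gapSum (hU : IsOpen U) (hq : Summable q)
    (hp : ∀ z ∈ U, ∀ k, ‖p z k‖ ≤ q k) (hd : ∀ k, DifferentiableOn ℂ (fun z => p z k) U)
    (m : ℕ) (a : ℤ) : DifferentiableOn ℂ (fun z => gapSum (p z) m a) U := by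
  induction m generalizing a with
  | zero => exact differentiableOn_const _
  | succ m ih =>
    refine Complex.differentiableOn_tsum_of_summable_norm
      ((summable_shift hq a).mul_right ((1 / 2) ^ m * Real.exp (2 * ∑' k, q k)))
      (fun j => (hd _).mul (ih _)) hU fun j z hz => ?_
    rw [norm_mul]
    exact mul_le_mul (hp z hz _) (norm_gapSum_le hq (hp z hz) m _) (norm_nonneg _)
      ((norm_nonneg _).trans (hp z hz _))

theorem differentiableOn_rightSum (hU : IsOpen U) (hq : Summable q)
    (hp : ∀ z ∈ U, ∀ k, ‖p z k‖ ≤ q k) (hd : ∀ k, DifferentiableOn ℂ (fun z => p z k) U)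
    (a : ℤ) : DifferentiableOn ℂ (fun z => rightSum (p z) a) U := by
  refine Complex.differentiableOn_tsum_of_summable_norm
    (summable_geometric_mul (Real.exp (2 * ∑' k, q k)))
    (fun m => (differentiableOn_gapSum hU hq hp hd m a).const_mul _) hU fun m z hz => ?_
  rw [norm_alternating]
  exact norm_gapSum_le hq (hp z hz) m a

theorem differentiableOn_leftSum (hU : IsOpen U) (hq : Summable q)
    (hp : ∀ z ∈ U, ∀ k, ‖p z k‖ ≤ q k) (hd : ∀ k, DifferentiableOn ℂ (fun z => p z k) U)
    (n : ℤ) : DifferentiableOn ℂ (fun z => leftSum (p z) n) U :=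
  differentiableOn_rightSum (p := fun z k => p z (-k - 1)) hU (summable_reflect hq)
    (fun z hz _ => hp z hz _) (fun _ => hd _) _

theorem differentiableOn_fullSum (hU : IsOpen U) (hq : Summable q)
    (hp : ∀ z ∈ U, ∀ k, ‖p z k‖ ≤ q k) (hd : ∀ k, DifferentiableOn ℂ (fun z => p z k) U) :
    DifferentiableOn ℂ (fun z => fullSum (p z)) U := by
  refine (differentiableOn_const _).sub (Complex.differentiableOn_tsum_of_summable_norm
    (hq.mul_right (2 * Real.exp (2 * ∑' k, q k)))
    (fun k => (hd k).mul (differentiableOn_rightSum hU hq hp hd _)) hU fun k z hz => ?_)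
  rw [norm_mul]
  exact mul_le_mul (hp z hz _) (norm_rightSum_le hq (hp z hz) _) (norm_nonneg _)
    ((norm_nonneg _).trans (hp z hz _))

end Analytic

/-! ### Decay from ratios, and Green's identity. -/

theorem tendsto_zero_of_ratio_atTop {p E : ℤ → ℂ} (hp : Tendsto p atTop (𝓝 0))
    (hE : ∀ n, E (n + 1) = p n * E n) : Tendsto E atTop (𝓝 0) := by
  rw [← Nat.map_cast_int_atTop, tendsto_map'_iff] at hp ⊢
  refine Summable.tendsto_atTop_zero
    (summable_of_ratio_norm_eventually_le (r := 1 / 2) (by norm_num) ?_)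
  have := (tendsto_order.1 hp.norm).2 (1 / 2) (by norm_num)
  filter_upwards [this] with n hn
  simp only [Function.comp_apply, Nat.cast_add, Nat.cast_one] at hn ⊢
  rw [hE, norm_mul]
  gcongr

theorem tendsto_zero_of_ratio_atBot {p E : ℤ → ℂ} (hp : Tendsto p atBot (𝓝 0))
    (hE : ∀ n, E n = p n * E (n + 1)) : Tendsto E atBot (𝓝 0) := by
  have h := tendsto_zero_of_ratio_atTop (p := fun n => p (-n - 1)) (E := fun n => E (-n)) ?_ ?_
  · simpa [Function.comp_def] using h.comp tendsto_neg_atBot_atTop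
  · exact hp.comp (tendsto_atBot_add_const_right _ (-1) tendsto_neg_atTop_atBot)
  · intro n
    rw [hE (-(n + 1))]
    ring_nf

theorem step_le_of_monotone {C : ℤ → ℝ} {a b : ℝ} (hC : ∀ n, C (n - 1) ≤ C n)
    (ha : Tendsto C atBot (𝓝 a)) (hb : Tendsto C atTop (𝓝 b)) (m : ℤ) :
    C m - C (m - 1) ≤ b - a := by
  have hmono : Monotone C := monotone_int_of_le_succ fun n => by simpa using hC (n + 1)
  linarith [hmono.le_of_tendsto ha (m - 1), hmono.ge_of_tendsto hb m]

/-- Green's identity for a decaying solution of the Jacobi recurrence with a point source. -/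
theorem abs_im_mul_sq_norm_le {lam w : ℤ → ℝ} {z c : ℂ} {u : ℤ → ℂ} {N : ℤ}
    (hu : ∀ n, w (n - 1) * u (n - 1) + (lam n - z) * u n + w n * u (n + 1) =
      if n = N then c else 0)
    (htop : Tendsto (fun n => w n * (u n * u (n + 1))) atTop (𝓝 0))
    (hbot : Tendsto (fun n => w n * (u n * u (n + 1))) atBot (𝓝 0)) (m : ℤ) :
    |z.im| * ‖u m‖ ^ 2 ≤ ‖u N‖ * ‖c‖ := by
  -- `B` is the flux of the solution; subtracting the jump `κ` caused by the source leaves `C` with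
  -- increments Im z · |u_n|², all of one sign. Each increment is thus at most the total variation
  -- |κ|.
  set κ : ℝ := (c * star (u N)).im with hκ
  set B : ℤ → ℝ := fun n => (w n * (u (n + 1) * star (u n))).im with hB
  set C : ℤ → ℝ := fun n => B n - if N ≤ n then κ else 0 with hC
  have hBlim : ∀ l : Filter ℤ, Tendsto (fun n => w n * (u n * u (n + 1))) l (𝓝 0) →
      Tendsto B l (𝓝 0) := fun l hl => by
    refine squeeze_zero_norm (fun n => ?_) (tendsto_zero_iff_norm_tendsto_zero.1 hl)
    refine (Complex.abs_im_le_norm _).trans_eq ?_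
    simp only [norm_mul, norm_star]
    ring
  have hCbot : Tendsto C atBot (𝓝 0) := by
    refine (hBlim _ hbot).congr' ?_
    filter_upwards [eventually_lt_atBot N] with n hn
    simp [hC, not_le.2 hn]
  have hCtop : Tendsto C atTop (𝓝 (-κ)) := by
    have := (hBlim _ htop).sub_const κ
    rw [zero_sub] at this
    refine this.congr' ?_
    filter_upwards [eventually_ge_atTop N] with n hn
    simp [hC, hn]
  have hstep : ∀ n, C n - C (n - 1) = z.im * ‖u n‖ ^ 2 := fun n => by
    have h := congrArg (fun t => (t * star (u n)).im) (hu n)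
    have hif : ((if N ≤ n then κ else 0) - if N ≤ n - 1 then κ else 0) =
        ((if n = N then c else 0) * star (u n)).im := by
      rcases lt_trichotomy n N with h' | h' | h'
      · rw [if_neg (by omega), if_neg (by omega), if_neg (by omega)]
        simp
      · subst h'
        simp [hκ]
      · rw [if_pos (by omega), if_pos (by omega), if_neg (by omega)]
        simp
    have h2 : C n - C (n - 1) = B n - B (n - 1) -
        ((if N ≤ n then κ else 0) - if N ≤ n - 1 then κ else 0) := by
      simp only [hC]
      ring
    rw [h2, hif, ← h, ← Complex.normSq_eq_norm_sq, Complex.normSq_apply]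
    simp only [hB, sub_add_cancel, Complex.star_def, Complex.add_im, Complex.mul_im,
      Complex.mul_re, Complex.add_re, Complex.sub_re, Complex.sub_im, Complex.ofReal_re,
      Complex.ofReal_im, Complex.conj_re, Complex.conj_im]
    ring
  have hκle : |κ| ≤ ‖u N‖ * ‖c‖ := by
    refine (Complex.abs_im_le_norm _).trans_eq ?_
    rw [norm_mul, norm_star, mul_comm]
  rcases le_total 0 z.im with hz | hz
  · have := step_le_of_monotone (fun n => sub_nonneg.1 (by rw [hstep]; positivity)) hCbot hCtop m
    rw [hstep] at this
    rw [abs_of_nonneg hz]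
    linarith [neg_abs_le κ]
  · have hneg : ∀ n, (-C n) - (-C (n - 1)) = -z.im * ‖u n‖ ^ 2 := fun n => by
      rw [neg_mul, ← hstep]
      ring
    have hz' : 0 ≤ -z.im := by linarith
    have := step_le_of_monotone (C := fun n => -C n)
      (fun n => sub_nonneg.1 (by rw [hneg]; positivity)) hCbot.neg hCtop.neg m
    rw [hneg] at this
    rw [abs_of_nonpos hz]
    linarith [le_abs_self κ]

/-! ### Solutions of the Jacobi equation decaying at each end. -/

/-- The solution of `P (n + 1) = r n * P n` on `ℤ` with `P 0 = 1`. -/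
def iterProd (r : ℤ → ℂ) : ℤ → ℂ
  | Int.ofNat n => ∏ i ∈ Finset.range n, r i
  | Int.negSucc n => (∏ i ∈ Finset.range (n + 1), r (-i - 1))⁻¹

theorem iterProd_succ {r : ℤ → ℂ} (hr : ∀ n, r n ≠ 0) (n : ℤ) :
    iterProd r (n + 1) = r n * iterProd r n := by
  rcases n with n | n
  · change ∏ i ∈ Finset.range (n + 1), r i = r n * ∏ i ∈ Finset.range n, r i
    rw [Finset.prod_range_succ, mul_comm]
  · rcases n with _ | n
    · simp [iterProd, hr]
    · rw [show Int.negSucc (n + 1) + 1 = Int.negSucc n by omega]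
      simp only [iterProd]
      rw [Finset.prod_range_succ _ (n + 1), mul_inv, mul_left_comm,
        show -((n + 1 : ℕ) : ℤ) - 1 = Int.negSucc (n + 1) by omega, mul_inv_cancel₀ (hr _), mul_one]

theorem iterProd_ne_zero {r : ℤ → ℂ} (hr : ∀ n, r n ≠ 0) (n : ℤ) : iterProd r n ≠ 0 := by
  rcases n with n | n
  · exact Finset.prod_ne_zero_iff.2 fun i _ => hr _
  · exact inv_ne_zero (Finset.prod_ne_zero_iff.2 fun i _ => hr _)

theorem continuousAt_iterProd {r : ℂ → ℤ → ℂ} {x : ℂ} (hr : ∀ n, r x n ≠ 0)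
    (hc : ∀ n, ContinuousAt (fun z => r z n) x) (n : ℤ) :
    ContinuousAt (fun z => iterProd (r z) n) x := by
  rcases n with n | n
  · exact tendsto_finsetProd _ fun i _ => hc _
  · exact (tendsto_finsetProd _ fun i _ => hc _).inv₀
      (Finset.prod_ne_zero_iff.2 fun i _ => hr _)

section Solutions

variable (lam w : ℤ → ℝ)

/-- The coefficients `w_k² / ((z - λ_k) (z - λ_{k+1}))`. -/
def coeff (z : ℂ) (k : ℤ) : ℂ := (w k : ℂ) ^ 2 / ((z - lam k) * (z - lam (k + 1)))

/-- The weights `∏ w_{k-1} / (z - λ_k)`. -/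
def weight (z : ℂ) (n : ℤ) : ℂ := iterProd (fun n => w n / (z - lam (n + 1))) n

/-- The solution decaying at `+∞`. -/
def rightSol (z : ℂ) (n : ℤ) : ℂ := weight lam w z n * rightSum (coeff lam w z) (n + 1)

/-- The solution decaying at `-∞`. -/
def leftSol (z : ℂ) (n : ℤ) : ℂ :=
  ((z - lam n) * weight lam w z n)⁻¹ * leftSum (coeff lam w z) (n - 1)

variable {lam w} {z : ℂ}

theorem weight_ratio_ne_zero (hw : ∀ n, w n ≠ 0) (hz : ∀ n, z - lam n ≠ 0) (n : ℤ) :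
    (w n : ℂ) / (z - lam (n + 1)) ≠ 0 :=
  div_ne_zero (Complex.ofReal_ne_zero.2 (hw n)) (hz _)

theorem weight_ne_zero (hw : ∀ n, w n ≠ 0) (hz : ∀ n, z - lam n ≠ 0) (n : ℤ) :
    weight lam w z n ≠ 0 :=
  iterProd_ne_zero (weight_ratio_ne_zero hw hz) n

theorem weight_succ (hw : ∀ n, w n ≠ 0) (hz : ∀ n, z - lam n ≠ 0) (n : ℤ) :
    weight lam w z (n + 1) = w n / (z - lam (n + 1)) * weight lam w z n :=
  iterProd_succ (weight_ratio_ne_zero hw hz) n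

/-- Dividing out the weights turns the Jacobi equation into `rightSum_rec`. -/
theorem rightSol_rec (hw : ∀ n, w n ≠ 0) (hz : ∀ n, z - lam n ≠ 0)
    (hp : Summable fun k => ‖coeff lam w z k‖) (n : ℤ) :
    w (n - 1) * rightSol lam w z (n - 1) + (lam n - z) * rightSol lam w z n +
      w n * rightSol lam w z (n + 1) = 0 := by
  have h0 := weight_succ hw hz (n - 1)
  have h1 := weight_succ hw hz n
  have h2 := rightSum_rec hp (fun k => le_rfl) n
  rw [sub_add_cancel] at h0
  simp only [rightSol]
  rw [sub_add_cancel, show n + 1 + 1 = n + 2 by ring, h2, h1, h0, coeff]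
  field_simp [hz n, hz (n + 1)]
  ring

theorem leftSol_rec (hw : ∀ n, w n ≠ 0) (hz : ∀ n, z - lam n ≠ 0)
    (hp : Summable fun k => ‖coeff lam w z k‖) (n : ℤ) :
    w (n - 1) * leftSol lam w z (n - 1) + (lam n - z) * leftSol lam w z n +
      w n * leftSol lam w z (n + 1) = 0 := by
  have h0 := weight_succ hw hz (n - 1)
  have h1 := weight_succ hw hz n
  have h2 := leftSum_rec hp n
  have hW := weight_ne_zero hw hz (n - 1)
  have hwn := Complex.ofReal_ne_zero.2 (hw n)
  have hwn' := Complex.ofReal_ne_zero.2 (hw (n - 1))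
  rw [sub_add_cancel] at h0
  simp only [leftSol]
  rw [add_sub_cancel_right, show n - 1 - 1 = n - 2 by ring, h2, h1, h0, coeff, sub_add_cancel]
  field_simp [hz n, hz (n + 1), hz (n - 1)]
  ring

theorem sol_wronskian (hw : ∀ n, w n ≠ 0) (hz : ∀ n, z - lam n ≠ 0)
    (hp : Summable fun k => ‖coeff lam w z k‖) (n : ℤ) :
    w n * (leftSol lam w z n * rightSol lam w z (n + 1) -
      leftSol lam w z (n + 1) * rightSol lam w z n) = -fullSum (coeff lam w z) := by
  have h1 := weight_succ hw hz n
  have hW := weight_ne_zero hw hz n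
  have hwn := Complex.ofReal_ne_zero.2 (hw n)
  rw [← wronskian_eq_fullSum hp n]
  simp only [leftSol, rightSol]
  rw [add_sub_cancel_right, show n + 1 + 1 = n + 2 by ring, h1, coeff]
  field_simp [hz n, hz (n + 1)]
  ring

theorem mul_weight_mul_weight (hw : ∀ n, w n ≠ 0) (hz : ∀ n, z - lam n ≠ 0) (n : ℤ) :
    w n * (weight lam w z n * weight lam w z (n + 1)) =
      (z - lam (n + 1)) * weight lam w z (n + 1) ^ 2 := by
  rw [weight_succ hw hz]
  field_simp [hz (n + 1)]

/-- E_n = (z - λ_n) W_n², with W the weight, has the summable coefficients as successive ratios, so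
E_n → 0 at +∞ and 1/E_n → 0 at -∞. By `mul_weight_mul_weight`, w_n W_n W_{n+1} = E_{n+1}, which
controls the boundary terms in Green's identity. -/
theorem scaled_weight_succ (hw : ∀ n, w n ≠ 0) (hz : ∀ n, z - lam n ≠ 0) (n : ℤ) :
    (z - lam (n + 1)) * weight lam w z (n + 1) ^ 2 =
      coeff lam w z n * ((z - lam n) * weight lam w z n ^ 2) := by
  rw [weight_succ hw hz, coeff]
  field_simp [hz n, hz (n + 1)]

theorem tendsto_rightSol (hw : ∀ n, w n ≠ 0) (hz : ∀ n, z - lam n ≠ 0)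
    (hp : Summable fun k => ‖coeff lam w z k‖) :
    Tendsto (fun n => w n * (rightSol lam w z n * rightSol lam w z (n + 1))) atTop (𝓝 0) := by
  have hE := tendsto_zero_of_ratio_atTop (E := fun n => (z - lam n) * weight lam w z n ^ 2)
    (tendsto_atTop_zero hp) (scaled_weight_succ hw hz)
  have hf := tendsto_rightSum_atTop hp
  have sh : ∀ c : ℤ, Tendsto (fun n : ℤ => n + c) atTop atTop := fun c =>
    tendsto_atTop_add_const_right _ c tendsto_id
  have := ((hE.comp (sh 1)).mul (hf.comp (sh 1))).mul (hf.comp (sh 2))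
  simp only [zero_mul] at this
  refine this.congr fun n => ?_
  simp only [Function.comp, rightSol]
  rw [← mul_weight_mul_weight hw hz, show n + 1 + 1 = n + 2 by ring]
  ring

theorem tendsto_leftSol (hw : ∀ n, w n ≠ 0) (hz : ∀ n, z - lam n ≠ 0)
    (hp : Summable fun k => ‖coeff lam w z k‖) :
    Tendsto (fun n => w n * (leftSol lam w z n * leftSol lam w z (n + 1))) atBot (𝓝 0) := by
  have hE : Tendsto (fun n => ((z - lam n) * weight lam w z n ^ 2)⁻¹) atBot (𝓝 0) := by
    refine tendsto_zero_of_ratio_atBot (tendsto_atBot_zero hp) fun n => ?_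
    have hW := weight_ne_zero hw hz n
    have hwn := Complex.ofReal_ne_zero.2 (hw n)
    rw [scaled_weight_succ hw hz, coeff]
    field_simp [hz n, hz (n + 1)]
  have hg := tendsto_leftSum_atBot hp
  have sh : ∀ c : ℤ, Tendsto (fun n : ℤ => n + c) atBot atBot := fun c =>
    tendsto_atBot_add_const_right _ c tendsto_id
  have := (hE.mul (hg.comp (sh (-1)))).mul hg
  simp only [zero_mul] at this
  refine this.congr fun n => ?_
  have hW := weight_ne_zero hw hz n
  have hwn := Complex.ofReal_ne_zero.2 (hw n)
  simp only [Function.comp, leftSol]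
  rw [weight_succ hw hz, add_sub_cancel_right, ← sub_eq_add_neg]
  field_simp [hz n, hz (n + 1)]

/-- The Green function bound `|Im z| |φ_m ψ_n|² ≤ |φ_n ψ_n| |F(z)|` for `m ≤ n`. -/
theorem abs_im_mul_sq_norm_sol_le (hw : ∀ n, w n ≠ 0) (hz : ∀ n, z - lam n ≠ 0)
    (hp : Summable fun k => ‖coeff lam w z k‖) {m n : ℤ} (hmn : m ≤ n) :
    |z.im| * ‖leftSol lam w z m * rightSol lam w z n‖ ^ 2 ≤
      ‖leftSol lam w z n * rightSol lam w z n‖ * ‖fullSum (coeff lam w z)‖ := by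
  -- The source sits at `n`, where the Wronskian supplies -F; the estimate is read off at the site
  -- `m ≤ n`.
  have key := abs_im_mul_sq_norm_le (lam := lam) (w := w) (z := z)
    (c := -fullSum (coeff lam w z)) (N := n)
    (u := fun k => leftSol lam w z (min k n) * rightSol lam w z (max k n)) ?_ ?_ ?_ m
  · simpa [hmn] using key
  · intro k
    rcases lt_trichotomy k n with h | h | h
    · rw [if_neg h.ne, min_eq_left (by omega), min_eq_left (by omega), min_eq_left (by omega),
        max_eq_right (by omega), max_eq_right (by omega), max_eq_right (by omega)]
      linear_combination rightSol lam w z n * leftSol_rec hw hz hp k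
    · subst h
      rw [if_pos rfl, min_eq_left (by omega), min_self, min_eq_right (by omega),
        max_eq_right (by omega), max_self, max_eq_left (by omega)]
      linear_combination rightSol lam w z k * leftSol_rec hw hz hp k + sol_wronskian hw hz hp k
    · rw [if_neg h.ne', min_eq_right (by omega), min_eq_right (by omega), min_eq_right (by omega),
        max_eq_left (by omega), max_eq_left (by omega), max_eq_left (by omega)]
      linear_combination leftSol lam w z n * rightSol_rec hw hz hp k
  · have := (tendsto_rightSol hw hz hp).const_mul (leftSol lam w z n ^ 2)
    rw [mul_zero] at this
    refine this.congr' ?_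
    filter_upwards [eventually_ge_atTop n] with k hk
    rw [min_eq_right hk, min_eq_right (by omega), max_eq_left hk, max_eq_left (by omega)]
    ring
  · have := (tendsto_leftSol hw hz hp).const_mul (rightSol lam w z n ^ 2)
    rw [mul_zero] at this
    refine this.congr' ?_
    filter_upwards [eventually_lt_atBot n] with k hk
    rw [min_eq_left hk.le, min_eq_left (by omega), max_eq_right hk.le, max_eq_right (by omega)]
    ring

/-- The half-line sums tend to 1 at their own ends, so they are nonzero far enough out. -/
theorem exists_sol_ne_zero (hw : ∀ n, w n ≠ 0) (hz : ∀ n, z - lam n ≠ 0)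
    (hp : Summable fun k => ‖coeff lam w z k‖) :
    ∃ m n : ℤ, m ≤ n ∧ leftSol lam w z m * rightSol lam w z n ≠ 0 := by
  have hR := ((tendsto_rightSum_atTop hp).comp
    (tendsto_atTop_add_const_right atTop (1 : ℤ) tendsto_id)).eventually_ne one_ne_zero
  have hL := ((tendsto_leftSum_atBot hp).comp
    (tendsto_atBot_add_const_right atBot (-1 : ℤ) tendsto_id)).eventually_ne one_ne_zero
  obtain ⟨n, hn, hn0⟩ := (hR.and (eventually_ge_atTop 0)).exists
  obtain ⟨m, hm, hm0⟩ := (hL.and (eventually_le_atBot 0)).exists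
  refine ⟨m, n, hm0.trans hn0, mul_ne_zero (mul_ne_zero (inv_ne_zero (mul_ne_zero (hz m)
    (weight_ne_zero hw hz m))) ?_) (mul_ne_zero (weight_ne_zero hw hz n) hn)⟩
  simpa [sub_eq_add_neg] using hm

end Solutions

/-! ### Simplicity of zeros and local control of the coefficients. -/

theorem analyticOrderAt_eq_one_of_im_bound {F a b : ℂ → ℂ} {x : ℂ} (hF : AnalyticAt ℂ F x)
    (hx : F x = 0) (him : x.im = 0) (ha : ContinuousAt a x) (hb : ContinuousAt b x) (ha0 : a x ≠ 0)
    (h : ∀ᶠ z in 𝓝 x, |z.im| * ‖a z‖ ^ 2 ≤ ‖b z‖ * ‖F z‖) : analyticOrderAt F x = 1 := by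
  refine le_antisymm ?_ (Order.one_le_iff_ne_zero.2 (hF.analyticOrderAt_ne_zero.2 hx))
  by_contra hlt
  have h2 : ((2 : ℕ) : ℕ∞) ≤ analyticOrderAt F x := by
    have := Order.add_one_le_of_lt (not_le.1 hlt)
    rwa [one_add_one_eq_two] at this
  obtain ⟨g, hg, hFg⟩ := (natCast_le_analyticOrderAt hF).1 h2
  -- On this vertical path |Im z| = |z - x| = ε. If F = (z - x)² g, dividing the bound by ε gives
  -- |a|² ≤ ε |b| |g|, hence a(x) = 0.
  set l : ℝ → ℂ := fun ε => x + ε * Complex.I with hl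
  have hlx : Tendsto l (𝓝[>] 0) (𝓝 x) := by
    have : Continuous l := by fun_prop
    have h0 := (this.tendsto 0).mono_left (nhdsWithin_le_nhds (s := Set.Ioi 0))
    simpa [hl] using h0
  have hid : Tendsto (fun ε : ℝ => ε) (𝓝[>] 0) (𝓝 0) := tendsto_id.mono_left nhdsWithin_le_nhds
  have hle : ∀ᶠ ε in 𝓝[>] (0 : ℝ), ‖a (l ε)‖ ^ 2 ≤ ε * (‖b (l ε)‖ * ‖g (l ε)‖) := by
    filter_upwards [hlx.eventually h, hlx.eventually hFg, self_mem_nhdsWithin] with ε h1 h3 hε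
    have hε : 0 < ε := hε
    have him' : |(l ε).im| = ε := by simp [hl, him, abs_of_pos hε]
    have hnorm : ‖l ε - x‖ = ε := by simp [hl, abs_of_pos hε]
    rw [him', h3, smul_eq_mul, norm_mul, norm_pow, hnorm] at h1
    refine le_of_mul_le_mul_left ?_ hε
    linarith
  have hlim := hid.mul (((hb.tendsto.comp hlx).norm).mul ((hg.continuousAt.tendsto.comp hlx).norm))
  rw [zero_mul] at hlim
  have hle0 := le_of_tendsto_of_tendsto ((ha.tendsto.comp hlx).norm.pow 2) hlim hle
  have := norm_pos_iff.2 ha0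
  nlinarith

/-- The ratios |λ_n - z₀| / |z - λ_n| are bounded by a constant `K` near `x`, so convergence at `z₀`
yields a uniform summable majorant, K² times the series at `z₀`. -/
theorem exists_ball_norm_coeff_le {lam w : ℤ → ℝ} {z₀ x : ℂ}
    (hz₀ : z₀ ∈ domC0 fun n => (lam n : ℂ)) (hx : x ∈ domC0 fun n => (lam n : ℂ))
    (hconv : ConvergenceCondition (fun n => (lam n : ℂ)) (fun n => (w n : ℂ)) z₀) :
    ∃ r > 0, ∃ q : ℤ → ℝ, Summable q ∧ (∀ z ∈ Metric.ball x r, ∀ n, z - lam n ≠ 0) ∧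
      ∀ z ∈ Metric.ball x r, ∀ k, ‖coeff lam w z k‖ ≤ q k := by
  have hz₀' : ∀ n, (lam n : ℂ) - z₀ ≠ 0 := fun n h =>
    hz₀ (subset_closure ⟨n, sub_eq_zero.1 h⟩)
  obtain ⟨d, hd, hball⟩ := Metric.isOpen_iff.1 isClosed_closure.isOpen_compl x hx
  have hfar : ∀ z ∈ Metric.ball x (d / 2), ∀ n, d / 2 ≤ ‖z - lam n‖ := fun z hz n => by
    have h1 : d ≤ dist (lam n : ℂ) x := by
      by_contra h
      exact hball (Metric.mem_ball.2 (not_le.1 h)) (subset_closure ⟨n, rfl⟩)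
    have h2 := dist_triangle (lam n : ℂ) z x
    rw [Metric.mem_ball] at hz
    rw [← dist_eq_norm, dist_comm]
    linarith
  -- From |λ_n - z₀| ≤ |z - λ_n| + d/2 + |x - z₀| and |z - λ_n| ≥ d/2.
  set K : ℝ := 1 + (d / 2 + ‖x - z₀‖) / (d / 2) with hK
  have hK0 : 0 ≤ K := by positivity
  have hratio : ∀ z ∈ Metric.ball x (d / 2), ∀ n, ‖(lam n : ℂ) - z₀‖ ≤ K * ‖z - lam n‖ := by
    intro z hz n
    have h1 := hfar z hz n
    rw [mem_ball_iff_norm] at hz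
    have h2 : ‖(lam n : ℂ) - z₀‖ ≤ ‖z - lam n‖ + ‖z - x‖ + ‖x - z₀‖ := by
      rw [← norm_neg (z - lam n), show (lam n : ℂ) - z₀ = -(z - lam n) + (z - x) + (x - z₀) by ring]
      exact norm_add₃_le
    have h3 : d / 2 + ‖x - z₀‖ ≤ (d / 2 + ‖x - z₀‖) / (d / 2) * ‖z - lam n‖ := by
      rw [div_mul_eq_mul_div, le_div_iff₀ (by positivity)]
      gcongr
    rw [hK]
    linarith
  have hne : ∀ z ∈ Metric.ball x (d / 2), ∀ n, z - lam n ≠ 0 := fun z hz n =>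
    norm_pos_iff.1 (lt_of_lt_of_le (by positivity) (hfar z hz n))
  refine ⟨d / 2, by positivity, _, hconv.mul_left (K ^ 2), hne, fun z hz k => ?_⟩
  have p1 := norm_pos_iff.2 (hne z hz k)
  have p2 := norm_pos_iff.2 (hne z hz (k + 1))
  have p3 := norm_pos_iff.2 (hz₀' k)
  have p4 := norm_pos_iff.2 (hz₀' (k + 1))
  rw [coeff, norm_div, norm_div, norm_mul, norm_mul, mul_div_assoc',
    div_le_div_iff₀ (by positivity) (by positivity)]
  have := mul_le_mul (hratio z hz k) (hratio z hz (k + 1)) p4.le (by positivity)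
  calc ‖(w k : ℂ) ^ 2‖ * (‖(lam k : ℂ) - z₀‖ * ‖(lam (k + 1) : ℂ) - z₀‖)
      ≤ ‖(w k : ℂ) ^ 2‖ * (K * ‖z - lam k‖ * (K * ‖z - lam (k + 1)‖)) := by gcongr
    _ = _ := by ring

/-- Only products of neighbouring terms enter, and there γ appears as (γ_k γ_{k+1})² = w_k². -/
theorem charFun_eq_fullSum {lam w : ℤ → ℝ} {γ : ℤ → ℂ}
    (hγ : IsFactorSeq (fun n => (w n : ℂ)) γ) {z : ℂ}
    (hp : Summable fun k => ‖coeff lam w z k‖) :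
    charFun (fun n => (lam n : ℂ)) γ z = fullSum (coeff lam w z) := by
  have h : (fun k => γ k ^ 2 / (z - lam k) * (γ (k + 1) ^ 2 / (z - lam (k + 1)))) =
      coeff lam w z := by
    ext k
    rw [div_mul_div_comm, ← mul_pow, hγ k, coeff]
  rw [charFun, frakF_eq_fullSum hp _ fun k => (congrArg norm (congrFun h k)).le, h]

end JacobiZeros

end

/-! ### Conclusion. -/

open JacobiZeros in
theorem mainTheorem10 (lam w : ℤ → ℝ) (hw : ∀ n, w n ≠ 0)
    (hconv : ∃ z₀ ∈ DoublyInfiniteJacobi.domC0 (fun n => (lam n : ℂ)),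
      DoublyInfiniteJacobi.ConvergenceCondition (fun n => (lam n : ℂ)) (fun n => (w n : ℂ)) z₀)
    (hder : DoublyInfiniteJacobi.der (fun n => (lam n : ℂ)) ≠ Set.range ((↑) : ℝ → ℂ))
    (γ : ℤ → ℂ) (hγ : DoublyInfiniteJacobi.IsFactorSeq (fun n => (w n : ℂ)) γ) :
    ∀ z ∈ DoublyInfiniteJacobi.domC0 (fun n => (lam n : ℂ)),
      DoublyInfiniteJacobi.charFun (fun n => (lam n : ℂ)) γ z = 0 →
        z ∈ Set.range ((↑) : ℝ → ℂ) ∧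
        analyticOrderAt (DoublyInfiniteJacobi.charFun (fun n => (lam n : ℂ)) γ) z = 1 := by
  intro x hx hzero
  obtain ⟨z₀, hz₀, hc⟩ := hconv
  obtain ⟨r, hr, q, hq, hne, hle⟩ := exists_ball_norm_coeff_le hz₀ hx hc
  have hU : Metric.ball x r ∈ 𝓝 x := Metric.ball_mem_nhds x hr
  have hxU : x ∈ Metric.ball x r := Metric.mem_ball_self hr
  have hp : ∀ z ∈ Metric.ball x r, Summable fun k => ‖coeff lam w z k‖ := fun z hz =>
    Summable.of_nonneg_of_le (fun _ => norm_nonneg _) (hle z hz) hq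
  have hd : ∀ k, DifferentiableOn ℂ (fun z => coeff lam w z k) (Metric.ball x r) := fun k =>
    (differentiableOn_const _).div
      ((differentiableOn_id.sub_const _).mul (differentiableOn_id.sub_const _))
      fun z hz => mul_ne_zero (hne z hz k) (hne z hz (k + 1))
  have hev : DoublyInfiniteJacobi.charFun (fun n => (lam n : ℂ)) γ =ᶠ[𝓝 x]
      fun z => fullSum (coeff lam w z) := by
    filter_upwards [hU] with z hz using charFun_eq_fullSum hγ (hp z hz)
  have hF0 : fullSum (coeff lam w x) = 0 := by rw [← hzero, hev.self_of_nhds]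
  -- The sites are fixed at `x`; the bound then holds for this same pair throughout the ball.
  obtain ⟨m, n, hmn, hmn0⟩ := exists_sol_ne_zero hw (hne x hxU) (hp x hxU)
  have hbound := fun z (hz : z ∈ Metric.ball x r) =>
    abs_im_mul_sq_norm_sol_le hw (hne z hz) (hp z hz) hmn
  have him : x.im = 0 := by
    have h := hbound x hxU
    rw [hF0, norm_zero, mul_zero] at h
    have := norm_pos_iff.2 hmn0
    by_contra him
    have := abs_pos.2 him
    exact absurd h (not_le.2 (by positivity))
  have hweight : ∀ k, ContinuousAt (fun z => weight lam w z k) x := fun k =>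
    continuousAt_iterProd (weight_ratio_ne_zero hw (hne x hxU))
      (fun j => continuousAt_const.div (continuousAt_id.sub continuousAt_const)
        (hne x hxU (j + 1))) k
  have hright : ∀ k, ContinuousAt (fun z => rightSol lam w z k) x := fun k =>
    (hweight k).mul
      ((differentiableOn_rightSum Metric.isOpen_ball hq hle hd (k + 1)).continuousOn.continuousAt hU)
  have hleft : ∀ k, ContinuousAt (fun z => leftSol lam w z k) x := fun k =>
    (((continuousAt_id.sub continuousAt_const).mul (hweight k)).inv₀
      (mul_ne_zero (hne x hxU k) (weight_ne_zero hw (hne x hxU) k))).mul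
      ((differentiableOn_leftSum Metric.isOpen_ball hq hle hd (k - 1)).continuousOn.continuousAt hU)
  refine ⟨⟨x.re, Complex.ext rfl him.symm⟩, ?_⟩
  rw [analyticOrderAt_congr hev]
  refine analyticOrderAt_eq_one_of_im_bound
    ((differentiableOn_fullSum Metric.isOpen_ball hq hle hd).analyticAt hU) hF0 him
    ((hleft m).mul (hright n)) ((hleft n).mul (hright n)) hmn0 ?_
  filter_upwards [hU] with z hz using hbound z hz
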